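/- \textbf{Theorem.} Let $p,q\ge 0$ be integers, $-\tfrac12<d<\tfrac12$, $\sigma_\epsilon^2>0$, and let $\phi(x)=1-\sum_{j=1}^p\phi_jx^j$ and $\psi(x)=1+\sum_{j=1}^q\psi_jx^j$ be real polynomials. Let $(\epsilon_n)_{n\in\mathbb Z}$ be independent $N(0,\sigma_\epsilon^2)$ random variables and let $X=(X_n)_{n\in\mathbb Z}$ be a (strictly) stationary Gaussian process satisfying $$\phi(L)(1-L)^dX_n=\psi(L)\epsilon_n\qquad\text{almost surely, for all } n\in\mathbb Z,$$ where $LX_n=X_{n-1}$ and $(1-L)^dX_n=\sum_{k\ge0}(-1)^k\binom dk X_{n-k}$, the series converging in mean square (an ARFIMA$(p,d,q)$ process). Assume the stationarity and invertibility conditions: every complex root $z$ of $\phi$ and every complex root $z$ of $\psi$ satisfies $|z|>1$. Then for every $n$ the vector $(X_1,\dots,X_n)$ has a Lebesgue density $f_n$ and a finite differential entropy $h(X_1,\dots,X_n)=-\int f_n\log f_n$, and the differential entropy rate of $X$ is $$\lim_{n\to\infty}\frac{h(X_1,\dots,X_n)}n=\tfrac12\log(2\pi e\,\sigma_\epsilon^2).$$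 In particular, the same holds for stationary Gaussian AR$(p)$ processes ($\phi(L)X_n=\epsilon_n$, with all roots of $\phi$ outside the closed unit disc), invertible MA$(q)$ processes ($X_n=\psi(L)\epsilon_n$, with all roots of $\psi$ outside the closed unit disc), and stationary invertible ARMA$(p,q)$ processes ($\phi(L)X_n=\psi(L)\epsilon_n$, with all roots of $\phi$ and of $\psi$ outside the closed unit disc). -/

import Mathlib

open MeasureTheory ProbabilityTheory Filter Topology Polynomial
open scoped NNReal ENNReal

noncomputable section

/-- The autoregressive polynomial `1 - ∑_{j=1}^p φ_j x^j`; the coefficient `φ_j` is `φ (j-1)`. -/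
def arPoly {p : ℕ} (φ : Fin p → ℝ) : ℝ[X] := 1 - ∑ j : Fin p, C (φ j) * X ^ ((j : ℕ) + 1)

/-- The moving-average polynomial `1 + ∑_{j=1}^q ψ_j x^j`; the coefficient `ψ_j` is `ψ (j-1)`. -/
def maPoly {q : ℕ} (ψ : Fin q → ℝ) : ℝ[X] := 1 + ∑ j : Fin q, C (ψ j) * X ^ ((j : ℕ) + 1)

/-- All complex roots of the polynomial lie strictly outside the closed unit disc: the
stationarity condition when `a` is the autoregressive polynomial, the invertibility condition when
it is the moving-average polynomial. -/
def RootsOutsideUnitDisc (a : ℝ[X]) : Prop := ∀ z : ℂ, aeval z a = 0 → 1 < ‖z‖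

section Processes

variable {Ω : Type*} [MeasurableSpace Ω]

/-- The process `a(L) Y`, where `L` is the lag operator `(L Y)_n = Y_{n-1}`. -/
def lagApply (a : ℝ[X]) (Y : ℤ → Ω → ℝ) (n : ℤ) (ω : Ω) : ℝ :=
  a.sum fun j c => c * Y (n - (j : ℤ)) ω

/-- The coefficient of `x ^ k` in the binomial series of `(1 - x) ^ d`. -/
def fracDiffCoeff (d : ℝ) (k : ℕ) : ℝ := (-1) ^ k * Ring.choose d k

/-- `Y = (1 - L)^d Z`: for each `n` the series `∑_k π_k Z_{n-k}`, with `∑_k π_k x^k` the binomial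
series of `(1 - x)^d`, converges in mean square to the square-integrable variable `Y_n`. -/
def IsFracDiff (d : ℝ) (Z Y : ℤ → Ω → ℝ) (P : Measure Ω) : Prop :=
  ∀ n : ℤ, MemLp (Y n) 2 P ∧
    Tendsto (fun N : ℕ => eLpNorm
      (fun ω => (∑ k ∈ Finset.range N, fracDiffCoeff d k * Z (n - (k : ℤ)) ω) - Y n ω) 2 P)
      atTop (𝓝 0)

/-- A (strictly) stationary process: its law is invariant under all time shifts. -/
def IsStationaryProcess (Z : ℤ → Ω → ℝ) (P : Measure Ω) : Prop :=
  ∀ m : ℤ, IdentDistrib (fun ω (i : ℤ) => Z (i + m) ω) (fun ω (i : ℤ) => Z i ω) P P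

/-- Gaussian innovations: independent, each with law `N(0, σ²)`, where `v = σ²`. -/
def IsGaussianNoise (ε : ℤ → Ω → ℝ) (v : ℝ≥0) (P : Measure Ω) : Prop :=
  iIndepFun ε P ∧ ∀ n, HasLaw (ε n) (gaussianReal 0 v) P

/-- `Z` is a stationary Gaussian process with `a(L) (1 - L)^d Z_n = b(L) ε_n` for all `n`, almost
surely, where `ε` is Gaussian noise of variance `v`. -/
def IsARFIMA (a b : ℝ[X]) (d : ℝ) (Z ε : ℤ → Ω → ℝ) (v : ℝ≥0) (P : Measure Ω) : Prop :=
  IsGaussianProcess Z P ∧ IsStationaryProcess Z P ∧ IsGaussianNoise ε v P ∧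
    ∃ Y : ℤ → Ω → ℝ, IsFracDiff d Z Y P ∧ ∀ n, lagApply a Y n =ᵐ[P] lagApply b ε n

/-- `Z` is a stationary Gaussian process with `a(L) Z_n = b(L) ε_n` for all `n`, almost surely,
where `ε` is Gaussian noise of variance `v`. It is an autoregressive process when `b = 1` and a
moving-average process when `a = 1`. -/
def IsARMA (a b : ℝ[X]) (Z ε : ℤ → Ω → ℝ) (v : ℝ≥0) (P : Measure Ω) : Prop :=
  IsGaussianProcess Z P ∧ IsStationaryProcess Z P ∧ IsGaussianNoise ε v P ∧
    ∀ n, lagApply a Z n =ᵐ[P] lagApply b ε n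

/-- The block `(Z_1, …, Z_n)` as a random vector. -/
def block (Z : ℤ → Ω → ℝ) (n : ℕ) (ω : Ω) : Fin n → ℝ := fun i => Z ((i : ℤ) + 1) ω

/-- The joint differential entropy `-∫ f log f` of a random vector with Lebesgue density `f`
(meaningful when there is such a density and `f log f` is integrable). -/
def differentialEntropy {n : ℕ} (V : Ω → Fin n → ℝ) (P : Measure Ω) : ℝ :=
  -∫ x : Fin n → ℝ, (pdf V P volume x).toReal * Real.log (pdf V P volume x).toReal

/-- The process `Z` has differential entropy rate `h`: every block `(Z_1, …, Z_n)` has a density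
and a well-defined finite joint differential entropy, and `h(Z_1, …, Z_n) / n` tends to `h`. -/
def HasEntropyRate (Z : ℤ → Ω → ℝ) (P : Measure Ω) (h : ℝ) : Prop :=
  (∀ n : ℕ, HasPDF (block Z n) P volume ∧
    Integrable (fun x : Fin n → ℝ =>
      (pdf (block Z n) P volume x).toReal * Real.log (pdf (block Z n) P volume x).toReal)) ∧
  Tendsto (fun n : ℕ => differentialEntropy (block Z n) P / (n : ℝ)) atTop (𝓝 h)

end Processes

end

/-! By the chain rule, the entropy of a Gaussian block is the sum over `k` of `½ log (2πe s_k)`,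
where `s_k` is the variance of the error in predicting `Z_{k+1}` linearly from `Z_1, …, Z_k`. If
`s_k → σ²`, with `σ²` the noise variance `v`, Cesàro averaging gives the rate. So the theorem says
that `ε_n` is the innovation of `Z`, and no spectral density is needed.

Work in `L²` after centering, with `z`, `y`, `e` the images of `Z`, `Y = (1-L)^d Z` and `ε`. Two
facts identify the innovation. First, `e n - z n` lies in the closed span of the past of `z`
(`noise_sub_mem_closure_span`): the roots of the moving-average polynomial allow `e` to be recovered
from past and present `y`, hence `z`. Second, `e n` is orthogonal to that past
(`inner_noise_eq_zero`). Stationarity then transfers the infinite-past prediction error to finite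
pasts (`exists_innovations`).

The second fact is the delicate one. The roots of the autoregressive polynomial show only that `y 0`
is orthogonal to future noise. To pass to `z`, put `r m = ⟪z 0, e (m+1)⟫`. It is square-summable by
Bessel's inequality and is annihilated by the adjoint of `(1-L)^d`, which is injective on such
sequences for `|d| < 1/2` (`eq_zero_of_fracDiff_adjoint_eq_zero`). -/

/-! ### Binomial coefficients of `(1-x)^d` and injectivity of the adjoint operator. -/

section FractionalCoefficients

lemma fracDiffCoeff_zero_right (d : ℝ) : fracDiffCoeff d 0 = 1 := by
  simp [fracDiffCoeff]

lemma fracDiffCoeff_succ (d : ℝ) (k : ℕ) :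
    ((k : ℝ) + 1) * fracDiffCoeff d (k + 1) = (k - d) * fracDiffCoeff d k := by
  have hk : (k.factorial : ℝ) ≠ 0 := by positivity
  have hk1 : (k : ℝ) + 1 ≠ 0 := by positivity
  simp only [fracDiffCoeff, Ring.choose_eq_smul, descPochhammer_succ_right,
    Polynomial.smeval_mul, Polynomial.smeval_sub, Polynomial.smeval_X, Polynomial.smeval_natCast,
    Nat.factorial_succ, smul_eq_mul, Nat.cast_mul, Nat.cast_add, Nat.cast_one, pow_succ,
    pow_zero, nsmul_eq_mul, mul_one, one_mul]
  field_simp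
  ring

lemma fracDiffCoeff_succ' (d : ℝ) (k : ℕ) :
    fracDiffCoeff d (k + 1) = (k - d) / (k + 1) * fracDiffCoeff d k := by
  have h := fracDiffCoeff_succ d k
  field_simp
  linarith

lemma fracDiffCoeff_zero_left (k : ℕ) : fracDiffCoeff 0 k = if k = 0 then 1 else 0 := by
  rw [fracDiffCoeff, Ring.choose_zero_ite]
  split_ifs with h <;> simp [h]

lemma sum_antidiagonal_fracDiffCoeff (d : ℝ) (n : ℕ) :
    ∑ ij ∈ Finset.HasAntidiagonal.antidiagonal n, fracDiffCoeff (-d) ij.1 * fracDiffCoeff d ij.2 =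
      if n = 0 then 1 else 0 := by
  have h := Ring.add_choose_eq n (Commute.all (-d) d)
  rw [neg_add_cancel, Ring.choose_zero_ite] at h
  have h2 : ∑ ij ∈ Finset.HasAntidiagonal.antidiagonal n, fracDiffCoeff (-d) ij.1 * fracDiffCoeff d ij.2 =
      (-1) ^ n * ∑ ij ∈ Finset.HasAntidiagonal.antidiagonal n, Ring.choose (-d) ij.1 * Ring.choose d ij.2 := by
    rw [Finset.mul_sum]
    refine Finset.sum_congr rfl fun ij hij => ?_
    rw [← Finset.HasAntidiagonal.mem_antidiagonal.1 hij, pow_add, fracDiffCoeff, fracDiffCoeff]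
    ring
  rw [h2, ← h]
  split_ifs with hn <;> simp [hn]

lemma fracDiffCoeff_nonneg {d : ℝ} (hd : d ≤ 0) (k : ℕ) : 0 ≤ fracDiffCoeff d k := by
  induction k with
  | zero => simp [fracDiffCoeff_zero_right]
  | succ k ih =>
    rw [fracDiffCoeff_succ']
    have : 0 ≤ (k : ℝ) - d := by linarith [k.cast_nonneg (α := ℝ)]
    positivity

lemma fracDiffCoeff_succ_nonpos {d : ℝ} (hd : 0 ≤ d) (hd1 : d ≤ 1) (k : ℕ) :
    fracDiffCoeff d (k + 1) ≤ 0 := by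
  induction k with
  | zero => rw [fracDiffCoeff_succ', fracDiffCoeff_zero_right]; simpa using hd
  | succ k ih =>
    rw [fracDiffCoeff_succ']
    have : 0 ≤ ((k + 1 : ℕ) : ℝ) - d := by push_cast; linarith [k.cast_nonneg (α := ℝ)]
    exact mul_nonpos_of_nonneg_of_nonpos (by positivity) ih

/-- The recursion makes the sum telescope: `d π_k = k π_k - (k+1) π_{k+1}`. It yields the sign of
the partial sums. -/
lemma mul_sum_fracDiffCoeff (d : ℝ) (K : ℕ) :
    d * ∑ k ∈ Finset.range (K + 1), fracDiffCoeff d k =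
      -((K + 1) * fracDiffCoeff d (K + 1)) := by
  induction K with
  | zero => simp [fracDiffCoeff_zero_right, fracDiffCoeff_succ']
  | succ K ih =>
    rw [Finset.sum_range_succ, mul_add, ih]
    have := fracDiffCoeff_succ d (K + 1)
    push_cast at this ⊢
    linarith

lemma sum_fracDiffCoeff_nonneg {d : ℝ} (hd : 0 ≤ d) (hd1 : d ≤ 1) (K : ℕ) :
    0 ≤ ∑ k ∈ Finset.range K, fracDiffCoeff d k := by
  rcases hd.eq_or_lt with rfl | hd'
  · exact Finset.sum_nonneg fun k _ => fracDiffCoeff_nonneg le_rfl k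
  · cases K with
    | zero => simp
    | succ K =>
      have h := mul_sum_fracDiffCoeff d K
      have h2 := fracDiffCoeff_succ_nonpos hd hd1 K
      have h3 : 0 ≤ -(((K : ℝ) + 1) * fracDiffCoeff d (K + 1)) := by
        rw [← mul_neg]; exact mul_nonneg (by positivity) (by linarith)
      rw [← h] at h3
      exact nonneg_of_mul_nonneg_right h3 hd'

/-- Square-summability of the binomial coefficients, by telescoping `k * π_k ^ 2`. -/
lemma summable_sq_fracDiffCoeff {d : ℝ} (hd : -(1 / 2) < d) (hd0 : d ≤ 0) :
    Summable fun k => fracDiffCoeff d k ^ 2 := by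
  -- Beyond `K` one has `(1+2d)k > 1`, which absorbs the term `d² ≤ 1/4` in the increment of `w`.
  obtain ⟨K, hK⟩ := exists_nat_gt (1 / (1 + 2 * d))
  have hδ : 0 < 1 + 2 * d := by linarith
  set w : ℕ → ℝ := fun k => k * fracDiffCoeff d k ^ 2 with hw
  have step : ∀ k, K < k → (1 + 2 * d) / 4 * fracDiffCoeff d k ^ 2 ≤ w k - w (k + 1) := by
    intro k hk
    have hkK : 1 / (1 + 2 * d) < k := hK.trans (by exact_mod_cast hk)
    rw [div_lt_iff₀ hδ] at hkK
    have hk0 : (1 : ℝ) ≤ k := by exact_mod_cast (by omega : 1 ≤ k)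
    have e : w k - w (k + 1) =
        ((1 + 2 * d) * k - d ^ 2) / (k + 1) * fracDiffCoeff d k ^ 2 := by
      simp only [hw, fracDiffCoeff_succ']
      push_cast
      field_simp
      ring
    rw [e]
    refine mul_le_mul_of_nonneg_right ?_ (sq_nonneg _)
    rw [le_div_iff₀ (by positivity)]
    nlinarith
  rw [← summable_nat_add_iff (K + 1)]
  refine summable_of_sum_range_le (c := 4 / (1 + 2 * d) * w (K + 1)) (fun _ => sq_nonneg _) ?_
  intro n
  have tel : ∀ n, ∑ i ∈ Finset.range n, (1 + 2 * d) / 4 * fracDiffCoeff d (i + (K + 1)) ^ 2 ≤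
      w (K + 1) - w (n + (K + 1)) := by
    intro n
    induction n with
    | zero => simp
    | succ n ih =>
      rw [Finset.sum_range_succ]
      have := step (n + (K + 1)) (by omega)
      rw [show n + 1 + (K + 1) = n + (K + 1) + 1 by ring]
      linarith
  have h := tel n
  rw [← Finset.mul_sum] at h
  have hwn : 0 ≤ w (n + (K + 1)) := by simp only [hw]; positivity
  rw [div_mul_eq_mul_div, le_div_iff₀ hδ]
  linarith

/-- The coefficients of `(1 - x) ^ d` times the truncation at `N` of the series `(1 - x) ^ (-d)`. -/
noncomputable def truncInvCoeff (d : ℝ) (N l : ℕ) : ℝ :=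
  ∑ j ∈ Finset.range (N + 1), if j ≤ l then fracDiffCoeff (-d) j * fracDiffCoeff d (l - j) else 0

/-- Truncating at `N` does not affect degrees up to `N`, where the product is that of the full
series, namely `1`. -/
lemma truncInvCoeff_of_le (d : ℝ) {N l : ℕ} (h : l ≤ N) :
    truncInvCoeff d N l = if l = 0 then 1 else 0 := by
  rw [← sum_antidiagonal_fracDiffCoeff, Finset.Nat.sum_antidiagonal_eq_sum_range_succ
    (fun i j => fracDiffCoeff (-d) i * fracDiffCoeff d j), truncInvCoeff, ← Finset.sum_filter]
  refine Finset.sum_congr ?_ fun _ _ => rfl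
  ext j
  simp only [Finset.mem_filter, Finset.mem_range]
  omega

lemma sum_truncInvCoeff_mul (d : ℝ) (N L : ℕ) (r : ℕ → ℝ) :
    ∑ l ∈ Finset.range L, truncInvCoeff d N l * r l =
      ∑ j ∈ Finset.range (N + 1), fracDiffCoeff (-d) j *
        ∑ k ∈ Finset.range (L - j), fracDiffCoeff d k * r (k + j) := by
  simp only [truncInvCoeff, Finset.sum_mul]
  rw [Finset.sum_comm]
  refine Finset.sum_congr rfl fun j _ => ?_
  simp only [ite_mul, zero_mul]
  rw [← Finset.sum_filter, Finset.mul_sum]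
  refine Finset.sum_nbij' (fun l => l - j) (fun k => k + j) ?_ ?_ ?_ ?_ ?_ <;>
    simp only [Finset.mem_filter, Finset.mem_range]
  · intro a ha; omega
  · intro a ha; omega
  · intro a ha; omega
  · intro a ha; omega
  · intro a ha; rw [Nat.sub_add_cancel ha.2]; ring

/-- The coefficient at `0` is `1`, the later ones are nonpositive, and all partial sums are
nonnegative. Hence the later ones have total absolute value at most `1`, and so do their squares. -/
lemma sum_sq_truncInvCoeff_le_two {d : ℝ} (hd : 0 ≤ d) (hd1 : d ≤ 1) (N L : ℕ) :
    ∑ l ∈ Finset.range L, truncInvCoeff d N l ^ 2 ≤ 2 := by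
  have hneg : ∀ l, truncInvCoeff d N (l + 1) ≤ 0 := by
    intro l
    by_cases h : l + 1 ≤ N
    · rw [truncInvCoeff_of_le d h]; simp
    · refine Finset.sum_nonpos fun j hj => ?_
      rw [Finset.mem_range] at hj
      rw [if_pos (by omega)]
      obtain ⟨t, ht⟩ : ∃ t, l + 1 - j = t + 1 := ⟨l - j, by omega⟩
      rw [ht]
      exact mul_nonpos_of_nonneg_of_nonpos (fracDiffCoeff_nonneg (by linarith) _)
        (fracDiffCoeff_succ_nonpos hd hd1 _)
  have hsum : ∀ L, 0 ≤ ∑ l ∈ Finset.range L, truncInvCoeff d N l := by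
    intro L
    have h := sum_truncInvCoeff_mul d N L (fun _ => 1)
    simp only [mul_one] at h
    rw [h]
    exact Finset.sum_nonneg fun j _ => mul_nonneg (fracDiffCoeff_nonneg (by linarith) _)
      (sum_fracDiffCoeff_nonneg hd hd1 _)
  cases L with
  | zero => simp
  | succ L =>
    have h := hsum (L + 1)
    rw [Finset.sum_range_succ', truncInvCoeff_of_le d (Nat.zero_le N), if_pos rfl] at h ⊢
    have hnn : ∀ i ∈ Finset.range L, 0 ≤ -truncInvCoeff d N (i + 1) :=
      fun i _ => by linarith [hneg i]
    have h1 : ∑ i ∈ Finset.range L, -truncInvCoeff d N (i + 1) ≤ 1 := by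
      rw [Finset.sum_neg_distrib]; linarith
    have h2 : ∑ i ∈ Finset.range L, truncInvCoeff d N (i + 1) ^ 2 ≤
        ∑ i ∈ Finset.range L, -truncInvCoeff d N (i + 1) := by
      refine Finset.sum_le_sum fun i hi => ?_
      have := (Finset.single_le_sum hnn hi).trans h1
      nlinarith [hneg i]
    linarith

/-- For fixed `l` the coefficient decreases in `N`: it starts at `π_l` for `N = 0` and ends at `0`
or `1` once `N ≥ l`. So it lies between `0` and `π_l`. -/
lemma sum_sq_truncInvCoeff_le_tsum {d : ℝ} (hd : -(1 / 2) < d) (hd0 : d ≤ 0) (N L : ℕ) :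
    ∑ l ∈ Finset.range L, truncInvCoeff d N l ^ 2 ≤ ∑' l, fracDiffCoeff d l ^ 2 := by
  refine (Finset.sum_le_sum fun l _ => ?_).trans
    ((summable_sq_fracDiffCoeff hd hd0).sum_le_tsum _ fun _ _ => sq_nonneg _)
  have hterm : ∀ j, (if j + 1 ≤ l then
      fracDiffCoeff (-d) (j + 1) * fracDiffCoeff d (l - (j + 1)) else 0) ≤ 0 := by
    intro j
    split_ifs
    · exact mul_nonpos_of_nonpos_of_nonneg
        (fracDiffCoeff_succ_nonpos (by linarith) (by linarith) _) (fracDiffCoeff_nonneg hd0 _)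
    · exact le_rfl
  have hle : truncInvCoeff d N l ≤ fracDiffCoeff d l := by
    rw [truncInvCoeff, Finset.sum_range_succ']
    simp only [Nat.zero_le, if_true, fracDiffCoeff_zero_right, one_mul, Nat.sub_zero]
    linarith [Finset.sum_nonpos fun j (_ : j ∈ Finset.range N) => hterm j]
  have hnn : 0 ≤ truncInvCoeff d N l := by
    rcases le_total l N with h | h
    · rw [truncInvCoeff_of_le d h]; split_ifs <;> norm_num
    · have h1 := truncInvCoeff_of_le d (le_refl l)
      have h0 : (0 : ℝ) ≤ truncInvCoeff d l l := by rw [h1]; split_ifs <;> norm_num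
      refine h0.trans ?_
      obtain ⟨t, rfl⟩ := Nat.exists_eq_add_of_le h
      rw [truncInvCoeff, truncInvCoeff, show N + t + 1 = N + 1 + t by ring,
        Finset.sum_range_add _ (N + 1) t]
      refine add_le_of_nonpos_right (Finset.sum_nonpos fun i _ => ?_)
      rw [show N + 1 + i = N + i + 1 by ring]
      exact hterm _
  gcongr

/-- Injectivity of the adjoint fractional difference operator on square-summable sequences. -/
lemma eq_zero_of_fracDiff_adjoint_eq_zero {d : ℝ} (hd : -(1 / 2) < d) (hd' : d < 1 / 2)
    {r : ℕ → ℝ} (hr : Summable fun m => r m ^ 2)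
    (h : ∀ m, Tendsto (fun K => ∑ k ∈ Finset.range K, fracDiffCoeff d k * r (k + m))
      atTop (𝓝 0)) (m : ℕ) : r m = 0 := by
  obtain ⟨C, hC0, hC⟩ : ∃ C : ℝ, 0 ≤ C ∧
      ∀ N L, ∑ l ∈ Finset.range L, truncInvCoeff d N l ^ 2 ≤ C := by
    rcases le_total 0 d with h0 | h0
    · exact ⟨2, by norm_num, sum_sq_truncInvCoeff_le_two h0 (by linarith)⟩
    · exact ⟨_, tsum_nonneg fun _ => sq_nonneg _, sum_sq_truncInvCoeff_le_tsum hd h0⟩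
  have hlim : ∀ N, Tendsto (fun L => ∑ l ∈ Finset.range L, truncInvCoeff d N l * r (l + m))
      atTop (𝓝 0) := by
    intro N
    simp_rw [fun L => sum_truncInvCoeff_mul d N L (fun l => r (l + m))]
    rw [show (0 : ℝ) = ∑ j ∈ Finset.range (N + 1), fracDiffCoeff (-d) j * 0 by simp]
    refine tendsto_finsetSum _ fun j _ => Tendsto.const_mul _ ?_
    have := (h (j + m)).comp (tendsto_sub_atTop_nat j)
    simpa only [Function.comp_def, ← add_assoc] using this
  -- In the vanishing sum `hlim N`, the terms with `l ≤ N` reduce to `r m`. Cauchy-Schwarz bounds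
  -- the rest by a tail of `r`, with `C` independent of `N`.
  have hbound : ∀ N, r m ^ 2 ≤ C * ∑' i, r (i + (N + 1) + m) ^ 2 := by
    intro N
    have hs : Summable fun i => r (i + (N + 1) + m) ^ 2 := by
      simpa only [← add_assoc] using (summable_nat_add_iff (N + 1 + m)).2 hr
    have hl := ((hlim N).comp (tendsto_add_atTop_nat (N + 1))).const_sub (r m)
    rw [sub_zero] at hl
    refine le_of_tendsto (hl.pow 2) (Eventually.of_forall fun L => ?_)
    have hsplit : ∑ l ∈ Finset.range (L + (N + 1)), truncInvCoeff d N l * r (l + m) =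
        r m + ∑ i ∈ Finset.range L, truncInvCoeff d N (i + (N + 1)) * r (i + (N + 1) + m) := by
      rw [add_comm L, Finset.sum_range_add]
      congr 1
      · rw [Finset.sum_range_succ', Finset.sum_eq_zero, truncInvCoeff_of_le d (Nat.zero_le N)]
        · simp
        · intro i hi
          rw [Finset.mem_range] at hi
          rw [truncInvCoeff_of_le d (by omega)]; simp
      · simp only [add_comm (N + 1)]
    simp only [Function.comp_apply, hsplit]
    rw [sub_add_cancel_left, neg_sq]
    refine (Finset.sum_mul_sq_le_sq_mul_sq _ _ _).trans ?_
    refine mul_le_mul ?_ (hs.sum_le_tsum _ fun _ _ => sq_nonneg _)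
      (Finset.sum_nonneg fun _ _ => sq_nonneg _) hC0
    refine le_trans ?_ (hC N (L + (N + 1)))
    rw [add_comm L, Finset.sum_range_add]
    simp only [add_comm (N + 1)]
    exact le_add_of_nonneg_left (Finset.sum_nonneg fun _ _ => sq_nonneg _)
  have htail : Tendsto (fun N => C * ∑' i, r (i + (N + 1) + m) ^ 2) atTop (𝓝 (C * 0)) := by
    refine Tendsto.const_mul _ ?_
    have := (tendsto_sum_nat_add fun i => r i ^ 2).comp
      ((tendsto_add_atTop_nat m).comp (tendsto_add_atTop_nat 1))
    simpa only [Function.comp_def, ← add_assoc] using this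
  rw [mul_zero] at htail
  have := ge_of_tendsto' htail hbound
  exact pow_eq_zero_iff two_ne_zero |>.1 (le_antisymm this (sq_nonneg _))

end FractionalCoefficients

/-! ### Absolutely summable inverses of lag polynomials. -/

section CausalInverse

/-- Each factor `X - z` is inverted by a geometric series of ratio `z⁻¹`, and absolute summability
survives Cauchy products. -/
lemma exists_summable_inverse_multiset (s : Multiset ℂ) (hs : ∀ z ∈ s, 1 < ‖z‖) :
    ∃ q : PowerSeries ℂ, (Summable fun k => ‖PowerSeries.coeff k q‖) ∧
      q * ((s.map fun z => X - C z).prod : ℂ[X]) = 1 := by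
  induction s using Multiset.induction_on with
  | empty =>
    refine ⟨1, summable_of_ne_finset_zero (s := {0}) fun k hk => ?_, by simp⟩
    simp only [Finset.mem_singleton] at hk
    simp [PowerSeries.coeff_one, hk]
  | cons z s ih =>
    obtain ⟨q, hq, hqs⟩ := ih fun w hw => hs w (Multiset.mem_cons_of_mem hw)
    have hz : 1 < ‖z‖ := hs z (Multiset.mem_cons_self z s)
    have hz0 : z ≠ 0 := norm_pos_iff.1 (zero_lt_one.trans hz)
    set g : PowerSeries ℂ := PowerSeries.mk fun k => -(z⁻¹ ^ (k + 1)) with hg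
    have hgs : Summable fun k => ‖PowerSeries.coeff k g‖ := by
      simp only [hg, PowerSeries.coeff_mk, norm_neg, pow_succ, norm_mul, norm_pow]
      refine Summable.mul_right _ (summable_geometric_of_lt_one (norm_nonneg _) ?_)
      rw [norm_inv]; exact inv_lt_one_of_one_lt₀ hz
    have hginv : g * ((X - C z : ℂ[X]) : PowerSeries ℂ) = 1 := by
      ext n
      rw [Polynomial.coe_sub, Polynomial.coe_X, Polynomial.coe_C, mul_sub, map_sub,
        PowerSeries.coeff_mul_C]
      cases n with
      | zero => simp [hg, hz0]
      | succ n =>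
        rw [PowerSeries.coeff_succ_mul_X, PowerSeries.coeff_one]
        simp only [hg, PowerSeries.coeff_mk, pow_succ]
        field_simp
        simp
    refine ⟨g * q, ?_, ?_⟩
    · simp only [PowerSeries.coeff_mul]
      exact summable_norm_sum_mul_antidiagonal_of_summable_norm
        (f := fun k => PowerSeries.coeff k g) (g := fun k => PowerSeries.coeff k q) hgs hq
    · rw [Multiset.map_cons, Multiset.prod_cons, Polynomial.coe_mul, mul_mul_mul_comm, hginv, hqs,
        one_mul]

/-- A real polynomial without zeros in the closed unit disc has an absolutely summable inverse. -/
lemma exists_summable_inverse {a : ℝ[X]} (ha0 : a.coeff 0 = 1) (ha : RootsOutsideUnitDisc a) :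
    ∃ β : ℕ → ℝ, (Summable fun k => ‖β k‖) ∧ (a : PowerSeries ℝ) * PowerSeries.mk β = 1 := by
  have hne : a ≠ 0 := fun h => by simp [h] at ha0
  set p : ℂ[X] := a.map (algebraMap ℝ ℂ) with hp
  have hp0 : p ≠ 0 := (Polynomial.map_ne_zero_iff (algebraMap ℝ ℂ).injective).2 hne
  have hroots : ∀ z ∈ p.roots, 1 < ‖z‖ := fun z hz => ha z (by
    rw [Polynomial.aeval_def, ← Polynomial.eval_map]
    exact (Polynomial.mem_roots hp0).1 hz)
  obtain ⟨q, hq, hqs⟩ := exists_summable_inverse_multiset p.roots hroots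
  have hfac := (IsAlgClosed.splits p).eq_prod_roots
  have hlead : p.leadingCoeff ≠ 0 := Polynomial.leadingCoeff_ne_zero.2 hp0
  have hq' : PowerSeries.C p.leadingCoeff⁻¹ * q * (p : PowerSeries ℂ) = 1 := by
    rw [hfac, Polynomial.coe_mul, Polynomial.coe_C, ← hfac,
      show ∀ x y z w : PowerSeries ℂ, x * y * (z * w) = (x * z) * (y * w) by intros; ring,
      hqs, ← map_mul, inv_mul_cancel₀ hlead, map_one, one_mul]
  have hinv : (a : PowerSeries ℝ) * (a : PowerSeries ℝ)⁻¹ = 1 :=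
    PowerSeries.mul_inv_cancel _ (by simp [ha0])
  have hmap : (p : PowerSeries ℂ) * PowerSeries.map (algebraMap ℝ ℂ) (a : PowerSeries ℝ)⁻¹ = 1 := by
    rw [hp, Polynomial.polynomial_map_coe, ← map_mul, hinv, map_one]
  -- Uniqueness of inverses shows that the summable complex series has the coefficients of the real
  -- inverse.
  have heq : PowerSeries.C p.leadingCoeff⁻¹ * q =
      PowerSeries.map (algebraMap ℝ ℂ) (a : PowerSeries ℝ)⁻¹ :=
    left_inv_eq_right_inv hq' hmap
  refine ⟨fun k => PowerSeries.coeff k (a : PowerSeries ℝ)⁻¹, ?_, ?_⟩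
  · refine (hq.mul_left ‖p.leadingCoeff⁻¹‖).congr fun k => ?_
    rw [← norm_mul, ← PowerSeries.coeff_C_mul, heq, PowerSeries.coeff_map]
    simp
  · convert hinv
    ext; simp

/-- Inversion of the lag polynomial `a(L)` on bounded sequences. -/
lemma hasSum_inverse_lag {E : Type*} [NormedAddCommGroup E] [NormedSpace ℝ E] [CompleteSpace E]
    {a : ℝ[X]} {β : ℕ → ℝ} (hβ : Summable fun k => ‖β k‖)
    (hinv : (a : PowerSeries ℝ) * PowerSeries.mk β = 1)
    {f : ℤ → E} {B : ℝ} (hB : ∀ n, ‖f n‖ ≤ B) (n : ℤ) :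
    HasSum (fun j : ℕ => β j • a.sum fun i c => c • f (n - j - i)) (f n) := by
  have hs : ∀ i : ℕ, Summable fun j : ℕ => β j • a.coeff i • f (n - j - i) := by
    intro i
    refine Summable.of_norm_bounded (hβ.mul_right (‖a.coeff i‖ * B)) fun j => ?_
    rw [norm_smul, norm_smul]
    gcongr
    exact hB _
  set S : ℕ → E := fun i => ∑' j : ℕ, β j • a.coeff i • f (n - j - i)
  have h1 : HasSum (fun j : ℕ => β j • a.sum fun i c => c • f (n - j - i))
      (∑ i ∈ a.support, S i) := by
    simp only [Polynomial.sum_def, Finset.smul_sum]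
    exact hasSum_sum fun i _ => (hs i).hasSum
  -- Reindexing by the total lag `l = j + i` turns the double sum into a convolution, whose
  -- coefficients are those of `a · a⁻¹ = 1`.
  have h2 : ∀ i : ℕ, HasSum
      (fun l : ℕ => (a.coeff i * if i ≤ l then β (l - i) else 0) • f (n - l)) (S i) := by
    intro i
    rw [← (add_left_injective i).hasSum_iff]
    · convert (hs i).hasSum using 2 with j
      simp only [Function.comp_apply, Nat.le_add_left, if_true, Nat.add_sub_cancel, smul_smul]
      rw [mul_comm]
      congr 2
      push_cast; ring
    · intro l hl
      rw [if_neg, mul_zero, zero_smul]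
      exact fun h => hl ⟨l - i, Nat.sub_add_cancel h⟩
  have h3 := hasSum_sum fun i (_ : i ∈ a.support) => h2 i
  have hcoeff : ∀ l : ℕ, ∑ i ∈ a.support, (a.coeff i * if i ≤ l then β (l - i) else 0) =
      if l = 0 then 1 else 0 := by
    intro l
    rw [← PowerSeries.coeff_one, ← hinv]
    conv_rhs => rw [a.as_sum_support_C_mul_X_pow]
    rw [← Polynomial.coeToPowerSeries.ringHom_apply, map_sum, Finset.sum_mul, map_sum]
    refine Finset.sum_congr rfl fun i _ => ?_
    rw [Polynomial.coeToPowerSeries.ringHom_apply, Polynomial.coe_mul, Polynomial.coe_C,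
      Polynomial.coe_pow, Polynomial.coe_X, mul_assoc, PowerSeries.coeff_C_mul,
      PowerSeries.coeff_X_pow_mul']
    simp
  simp only [← Finset.sum_smul, hcoeff, ite_smul, one_smul, zero_smul] at h3
  have h4 : HasSum (fun l : ℕ => if l = 0 then f (n - l) else 0) (f n) := by
    simpa using hasSum_ite_eq (0 : ℕ) (f n) |>.congr_fun (by
      intro l; by_cases h : l = 0 <;> simp [h])
  rwa [h3.unique h4] at h1

end CausalInverse

/-! ### The noise as innovation, in a Hilbert space. -/

section InnovationsHilbert

open scoped InnerProductSpace

variable {H : Type*} [NormedAddCommGroup H] [InnerProductSpace ℝ H]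

/-- Two sequences are jointly stationary if their mutual inner products are shift-invariant. -/
def JointlyStationary (x w : ℤ → H) : Prop :=
  ∀ m i j : ℤ, ⟪x (i + m), w (j + m)⟫_ℝ = ⟪x i, w j⟫_ℝ

lemma JointlyStationary.symm {x w : ℤ → H} (h : JointlyStationary x w) :
    JointlyStationary w x := fun m i j => by
  rw [real_inner_comm, h, real_inner_comm]

lemma JointlyStationary.add {x w w' : ℤ → H} (h : JointlyStationary x w)
    (h' : JointlyStationary x w') : JointlyStationary x (fun n => w n + w' n) := fun m i j => by
  simp only [inner_add_right, h m i j, h' m i j]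

lemma JointlyStationary.sum_smul {x w : ℤ → H} (h : JointlyStationary x w) {ι : Type*}
    (s : Finset ι) (c : ι → ℝ) (τ : ι → ℤ) :
    JointlyStationary x (fun n => ∑ k ∈ s, c k • w (n - τ k)) := fun m i j => by
  simp only [inner_sum, inner_smul_right]
  refine Finset.sum_congr rfl fun k _ => ?_
  rw [← h m i (j - τ k), sub_add_eq_add_sub]

lemma JointlyStationary.tendsto {x w' : ℤ → H} {w : ℕ → ℤ → H}
    (h : ∀ N, JointlyStationary x (w N)) (hw : ∀ n, Tendsto (fun N => w N n) atTop (𝓝 (w' n))) :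
    JointlyStationary x w' := fun m i j => by
  have h1 := (hw (j + m)).inner (𝕜 := ℝ) (tendsto_const_nhds (x := x (i + m)))
  have h2 := (hw j).inner (𝕜 := ℝ) (tendsto_const_nhds (x := x i))
  rw [real_inner_comm, real_inner_comm (w' j)]
  refine tendsto_nhds_unique h1 (h2.congr fun N => ?_)
  rw [real_inner_comm, real_inner_comm _ (w N (j + m)), h N m i j]

variable {z y e : ℤ → H} {v d : ℝ} {a b : ℝ[X]}

lemma norm_le_of_inner_eq_ite (he : ∀ i j, ⟪e i, e j⟫_ℝ = if i = j then v else 0) (n : ℤ) :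
    ‖e n‖ ≤ √v := by
  rw [norm_eq_sqrt_real_inner, he, if_pos rfl]

variable [CompleteSpace H]

lemma exists_tendsto_noise (hb0 : b.coeff 0 = 1) (hb : RootsOutsideUnitDisc b)
    (he : ∀ i j, ⟪e i, e j⟫_ℝ = if i = j then v else 0)
    (hab : ∀ n : ℤ, (a.sum fun i c => c • y (n - i)) = b.sum fun i c => c • e (n - i)) :
    ∃ β : ℕ → ℝ, ∀ n : ℤ, Tendsto (fun N => ∑ j ∈ Finset.range N,
      β j • ∑ i ∈ a.support, a.coeff i • y (n - j - i)) atTop (𝓝 (e n)) := by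
  obtain ⟨β, hβ, hinv⟩ := exists_summable_inverse hb0 hb
  refine ⟨β, fun n => ?_⟩
  have h := (hasSum_inverse_lag hβ hinv (norm_le_of_inner_eq_ite he) n).tendsto_sum_nat
  simp only [← hab] at h
  exact h

/-- Only `z` is assumed stationary. Joint stationarity with the noise follows because `y` and `e`
are limits of the same finite filters of `z` at every time. -/
lemma jointlyStationary_of_arfima (hz : JointlyStationary z z)
    (hy : ∀ n : ℤ, Tendsto (fun N => ∑ k ∈ Finset.range N, fracDiffCoeff d k • z (n - k))
      atTop (𝓝 (y n)))
    (hb0 : b.coeff 0 = 1) (hb : RootsOutsideUnitDisc b)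
    (he : ∀ i j, ⟪e i, e j⟫_ℝ = if i = j then v else 0)
    (hab : ∀ n : ℤ, (a.sum fun i c => c • y (n - i)) = b.sum fun i c => c • e (n - i)) :
    JointlyStationary z e ∧ JointlyStationary y e := by
  obtain ⟨β, hβ⟩ := exists_tendsto_noise hb0 hb he hab
  have hY : ∀ x : ℤ → H, JointlyStationary x z → JointlyStationary x y := fun x hx =>
    .tendsto (fun N => hx.sum_smul (Finset.range N) (fracDiffCoeff d) (fun k => (k : ℤ))) hy
  have hE : ∀ x : ℤ → H, JointlyStationary x y → JointlyStationary x e := fun x hx =>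
    .tendsto (fun N => (hx.sum_smul a.support a.coeff (fun k => (k : ℤ))).sum_smul
      (Finset.range N) β (fun k => (k : ℤ))) hβ
  exact ⟨hE z (hY z hz), hE y (hY y (hY z hz).symm)⟩

/-- Orthogonality is proved first for `y`, by causal inversion of `a(L)`, and then for `z`, by
duality. This avoids proving that the series `(1-L)^(-d) y` converges to `z`. -/
lemma inner_noise_eq_zero (hd : -(1 / 2) < d) (hd' : d < 1 / 2) (hv : 0 < v)
    (hz : JointlyStationary z z)
    (hy : ∀ n : ℤ, Tendsto (fun N => ∑ k ∈ Finset.range N, fracDiffCoeff d k • z (n - k))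
      atTop (𝓝 (y n)))
    (ha0 : a.coeff 0 = 1) (ha : RootsOutsideUnitDisc a)
    (hb0 : b.coeff 0 = 1) (hb : RootsOutsideUnitDisc b)
    (he : ∀ i j, ⟪e i, e j⟫_ℝ = if i = j then v else 0)
    (hab : ∀ n : ℤ, (a.sum fun i c => c • y (n - i)) = b.sum fun i c => c • e (n - i))
    {j n : ℤ} (hjn : j < n) : ⟪z j, e n⟫_ℝ = 0 := by
  obtain ⟨hze, hye⟩ := jointlyStationary_of_arfima hz hy hb0 hb he hab
  have hy0 : ∀ n : ℤ, n < 0 → ⟪y 0, e (-n)⟫_ℝ = 0 := by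
    obtain ⟨α, hα, hinv⟩ := exists_summable_inverse ha0 ha
    have hbd : ∀ n : ℤ, ‖⟪y 0, e (-n)⟫_ℝ‖ ≤ ‖y 0‖ * √v := fun n =>
      (norm_inner_le_norm _ _).trans (by gcongr; exact norm_le_of_inner_eq_ite he _)
    intro n hn
    have h := hasSum_inverse_lag hα hinv hbd n
    -- Joint stationarity moves the lag from `e` to `y`; then `a(L) y = b(L) e` involves only noise
    -- up to time `0`, while `-m > 0`.
    have hzero : ∀ m : ℤ, m < 0 → (a.sum fun i c => c • ⟪y 0, e (-(m - i))⟫_ℝ) = 0 := by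
      intro m hm
      have h1 : (a.sum fun i c => c • ⟪y 0, e (-(m - i))⟫_ℝ) =
          ⟪a.sum fun i c => c • y (0 - i), e (-m)⟫_ℝ := by
        simp only [Polynomial.sum_def, sum_inner, real_inner_smul_left, smul_eq_mul]
        refine Finset.sum_congr rfl fun i _ => ?_
        rw [← hye i (0 - i) (-m), sub_add_cancel, neg_sub', sub_neg_eq_add]
      rw [h1, hab, Polynomial.sum_def, sum_inner]
      refine Finset.sum_eq_zero fun i _ => ?_
      rw [real_inner_smul_left, he, if_neg (by omega), mul_zero]
    have h0 : (fun j : ℕ => α j • a.sum fun i c => c • ⟪y 0, e (-(n - j - i))⟫_ℝ) = 0 := by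
      funext j
      rw [hzero (n - j) (by omega), smul_zero, Pi.zero_apply]
    rw [h0] at h
    exact h.unique hasSum_zero
  have hon : Orthonormal ℝ fun i => (√v)⁻¹ • e i := by
    rw [orthonormal_iff_ite]
    intro i j
    rw [real_inner_smul_left, real_inner_smul_right, he]
    split_ifs
    · rw [← mul_assoc, ← mul_inv, Real.mul_self_sqrt hv.le, inv_mul_cancel₀ hv.ne']
    · simp
  have hr : Summable fun m : ℕ => ⟪z 0, e (m + 1 : ℕ)⟫_ℝ ^ 2 := by
    have h := (hon.inner_products_summable (z 0)).comp_injective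
      (i := fun m : ℕ => ((m + 1 : ℕ) : ℤ)) (fun m m' h => by simpa using h)
    refine (h.mul_left v).congr fun m => ?_
    simp only [Function.comp_apply, real_inner_smul_left, norm_mul, mul_pow, Real.norm_eq_abs,
      sq_abs, inv_pow, Real.sq_sqrt hv.le]
    rw [← mul_assoc, mul_inv_cancel₀ hv.ne', one_mul, real_inner_comm]
  obtain ⟨m, hm⟩ : ∃ m : ℕ, n - j = (m + 1 : ℕ) := ⟨(n - j - 1).toNat, by omega⟩
  rw [← hze (-j) j n, add_neg_cancel, ← sub_eq_add_neg, hm]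
  -- By stationarity the adjoint sum at `m` is `⟪y 0, e (m+1)⟫`, which vanishes by `hy0`.
  refine eq_zero_of_fracDiff_adjoint_eq_zero hd hd' hr (fun m => ?_) m
  have h := (hy 0).inner (𝕜 := ℝ) (tendsto_const_nhds (x := e (m + 1 : ℕ)))
  rw [← neg_neg ((m + 1 : ℕ) : ℤ), hy0 _ (by omega), neg_neg] at h
  refine h.congr fun K => ?_
  rw [sum_inner]
  refine Finset.sum_congr rfl fun k _ => ?_
  rw [real_inner_smul_left, ← hze k (0 - k), sub_add_cancel]
  congr 3
  push_cast; ring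

/-- The innovation `e n` is the sum of `z n` and a limit of combinations of the past of `z`. -/
lemma noise_sub_mem_closure_span
    (hy : ∀ n : ℤ, Tendsto (fun N => ∑ k ∈ Finset.range N, fracDiffCoeff d k • z (n - k))
      atTop (𝓝 (y n)))
    (ha0 : a.coeff 0 = 1) (hb0 : b.coeff 0 = 1) (hb : RootsOutsideUnitDisc b)
    (he : ∀ i j, ⟪e i, e j⟫_ℝ = if i = j then v else 0)
    (hab : ∀ n : ℤ, (a.sum fun i c => c • y (n - i)) = b.sum fun i c => c • e (n - i))
    (n : ℤ) : e n - z n ∈ (Submodule.span ℝ (z '' Set.Iio n)).topologicalClosure := by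
  set K : ℤ → Submodule ℝ H := fun n => (Submodule.span ℝ (z '' Set.Iio n)).topologicalClosure
  have hmono : Monotone K := fun i j hij => Submodule.topologicalClosure_mono
    (Submodule.span_mono (Set.image_mono (Set.Iio_subset_Iio hij)))
  have hclosed : ∀ n, IsClosed (K n : Set H) := fun n => Submodule.isClosed_topologicalClosure _
  have hzK : ∀ {i n : ℤ}, i < n → z i ∈ K n := fun {i n} h =>
    Submodule.le_topologicalClosure _ (Submodule.subset_span ⟨i, h, rfl⟩)
  have hyz : ∀ n, y n - z n ∈ K n := by
    intro n
    have h := ((hy n).comp (tendsto_add_atTop_nat 1)).sub_const (z n)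
    refine (hclosed n).mem_of_tendsto h (Eventually.of_forall fun N => ?_)
    simp only [Function.comp_apply]
    rw [Finset.sum_range_succ', fracDiffCoeff_zero_right, one_smul, Nat.cast_zero, sub_zero,
      add_sub_cancel_right]
    exact Submodule.sum_mem _ fun k _ => Submodule.smul_mem _ _ (hzK (by push_cast; omega))
  have hyK : ∀ {i n : ℤ}, i < n → y i ∈ K n := fun {i n} h => by
    rw [← sub_add_cancel (y i) (z i)]
    exact add_mem (hmono h.le (hyz i)) (hzK h)
  obtain ⟨β, hβ⟩ := exists_tendsto_noise hb0 hb he hab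
  have heK : ∀ {i n : ℤ}, i < n → e i ∈ K n := fun {i n} h =>
    (hclosed n).mem_of_tendsto (hβ i) (Eventually.of_forall fun N =>
      Submodule.sum_mem _ fun j _ => Submodule.smul_mem _ _ <|
        Submodule.sum_mem _ fun l _ => Submodule.smul_mem _ _ (hyK (by omega)))
  -- Since both constant coefficients are `1`, the present terms of `a(L) y = b(L) e` give `e n - y
  -- n` modulo the past.
  have hlag : ∀ (p : ℝ[X]) (x : ℤ → H), p.coeff 0 = 1 → (∀ i, i < n → x i ∈ K n) →
      (p.sum fun i c => c • x (n - i)) - x n ∈ K n := by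
    intro p x hp hx
    have h0 : 0 ∈ p.support := by simp [hp]
    rw [Polynomial.sum_def, ← Finset.add_sum_erase _ _ h0, hp, one_smul, Nat.cast_zero, sub_zero,
      add_sub_cancel_left]
    refine Submodule.sum_mem _ fun i hi => Submodule.smul_mem _ _ (hx _ ?_)
    have := Finset.ne_of_mem_erase hi
    omega
  have h1 := hlag a y ha0 fun i hi => hyK hi
  have h2 := hlag b e hb0 fun i hi => heK hi
  rw [← hab] at h2
  have := add_mem (sub_mem h1 h2) (hyz n)
  convert this using 1
  abel

/-- Gram-Schmidt orthogonalisation of `z 1, z 2, …`: the residual variances stay above `v` and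
converge to `v`. -/
theorem exists_innovations (hd : -(1 / 2) < d) (hd' : d < 1 / 2) (hv : 0 < v)
    (hz : JointlyStationary z z)
    (hy : ∀ n : ℤ, Tendsto (fun N => ∑ k ∈ Finset.range N, fracDiffCoeff d k • z (n - k))
      atTop (𝓝 (y n)))
    (ha0 : a.coeff 0 = 1) (ha : RootsOutsideUnitDisc a)
    (hb0 : b.coeff 0 = 1) (hb : RootsOutsideUnitDisc b)
    (he : ∀ i j, ⟪e i, e j⟫_ℝ = if i = j then v else 0)
    (hab : ∀ n : ℤ, (a.sum fun i c => c • y (n - i)) = b.sum fun i c => c • e (n - i)) :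
    ∃ (c : ℕ → ℕ → ℝ) (g : ℕ → H),
      (∀ k : ℕ, g k = z (k + 1) - ∑ j ∈ Finset.range k, c k j • z (j + 1)) ∧
      (∀ i j, i ≠ j → ⟪g i, g j⟫_ℝ = 0) ∧ (∀ k, v ≤ ‖g k‖ ^ 2) ∧
      Tendsto (fun k => ‖g k‖ ^ 2) atTop (𝓝 v) := by
  have hze : ∀ {j n : ℤ}, j < n → ⟪z j, e n⟫_ℝ = 0 := fun {j n} h =>
    inner_noise_eq_zero hd hd' hv hz hy ha0 ha hb0 hb he hab h
  have hmem := noise_sub_mem_closure_span hy ha0 hb0 hb he hab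
  -- `e n - z n` lies in the closed past, which is orthogonal to `e n`, so `⟪z n, e n⟫ = ‖e n‖²`.
  have hzen : ∀ n : ℤ, ⟪z n, e n⟫_ℝ = v := by
    intro n
    have hle : (Submodule.span ℝ (z '' Set.Iio n)).topologicalClosure ≤ (ℝ ∙ e n)ᗮ := by
      refine Submodule.topologicalClosure_minimal _ ?_ (Submodule.isClosed_orthogonal _)
      rw [Submodule.span_le]
      rintro _ ⟨j, hj, rfl⟩
      rw [SetLike.mem_coe, Submodule.mem_orthogonal_singleton_iff_inner_left]
      exact hze hj
    have h := Submodule.mem_orthogonal_singleton_iff_inner_left.1 (hle (hmem n))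
    rw [inner_sub_left, he, if_pos rfl] at h
    linarith
  set w : ℕ → H := fun k => z (k + 1) with hw
  set U : ℕ → Submodule ℝ H := fun k => Submodule.span ℝ (w '' (Finset.range k : Finset ℕ))
  have : ∀ k, FiniteDimensional ℝ (U k) := fun k =>
    FiniteDimensional.span_of_finite ℝ ((Finset.finite_toSet _).image _)
  have hU : ∀ k, ∃ c : ℕ → ℝ, ∑ j ∈ Finset.range k, c j • w j = (U k).starProjection (w k) :=
    fun k => (Submodule.mem_span_image_finset_iff_exists_fun' ℝ).1
      (Submodule.starProjection_apply_mem _ _)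
  choose c hc using hU
  set g : ℕ → H := fun k => w k - (U k).starProjection (w k) with hg
  have horth : ∀ k, ∀ x ∈ U k, ⟪g k, x⟫_ℝ = 0 := fun k x hx =>
    Submodule.starProjection_inner_eq_zero _ _ hx
  have hwU : ∀ {j k : ℕ}, j < k → w j ∈ U k := fun {j k} h =>
    Submodule.subset_span ⟨j, by simpa using h, rfl⟩
  have hmono : Monotone U := fun i j hij => Submodule.span_mono
    (Set.image_mono (by simpa using hij))
  have hgU : ∀ {j k : ℕ}, j < k → g j ∈ U k := fun {j k} h =>
    sub_mem (hwU h) (hmono h.le (Submodule.starProjection_apply_mem _ _))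
  -- Subtracting past values leaves the inner product with `e (k+1)` equal to `v`; Cauchy-Schwarz
  -- then bounds `‖g k‖` from below.
  have hlower : ∀ k, √v ≤ ‖g k‖ := by
    intro k
    have h1 : ⟪g k, e (k + 1)⟫_ℝ = v := by
      rw [hg, inner_sub_left, hzen, ← hc k, sum_inner, Finset.sum_eq_zero, sub_zero]
      intro j hj
      rw [Finset.mem_range] at hj
      rw [real_inner_smul_left, hze (by omega), mul_zero]
    have h2 := real_inner_le_norm (g k) (e (k + 1))
    rw [h1] at h2
    have h3 := h2.trans (mul_le_mul_of_nonneg_left (norm_le_of_inner_eq_ite he _) (norm_nonneg _))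
    have h4 : 0 < √v := Real.sqrt_pos.2 hv
    nlinarith [Real.mul_self_sqrt hv.le]
  have hnorm : Tendsto (fun k => ‖g k‖) atTop (𝓝 √v) := by
    refine tendsto_order.2 ⟨fun x hx => Eventually.of_forall fun k => hx.trans_le (hlower k),
      fun x hx => ?_⟩
    -- A finite combination of the past already predicts `z 0` with error `S 0` of norm below `x`.
    -- Shifted to time `k+1` with `k ≥ M`, it uses only `z 1, …, z k`, so the optimal residual `g k`
    -- is no longer than `S (k+1)`.
    obtain ⟨s, hs, hdist⟩ := Metric.mem_closure_iff.1 (hmem 0) (x - √v) (by linarith)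
    obtain ⟨l, hl, rfl⟩ := (Finsupp.mem_span_image_iff_linearCombination ℝ).1 hs
    rw [Finsupp.mem_supported] at hl
    set S : ℤ → H := fun n => z n + ∑ j ∈ l.support, l j • z (n - -j) with hS
    have hSS : JointlyStationary S S :=
      (hz.add (hz.sum_smul _ _ _)).symm.add ((hz.add (hz.sum_smul _ _ _)).symm.sum_smul _ _ _)
    have hS0 : ‖S 0‖ < x := by
      have h1 : S 0 = e 0 - (e 0 - z 0 - Finsupp.linearCombination ℝ z l) := by
        simp only [hS, Finsupp.linearCombination_apply, Finsupp.sum, zero_sub, neg_neg]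
        abel
      rw [h1]
      rw [dist_eq_norm] at hdist
      refine (norm_sub_le _ _).trans_lt ?_
      linarith [norm_le_of_inner_eq_ite he 0]
    have hSn : ∀ n, ‖S n‖ = ‖S 0‖ := fun n => by
      rw [norm_eq_sqrt_real_inner, norm_eq_sqrt_real_inner, ← hSS n 0 0, zero_add]
    obtain ⟨M, hM⟩ : ∃ M : ℕ, ∀ j ∈ l.support, -(M : ℤ) ≤ j := by
      refine ⟨l.support.sup fun j => j.natAbs, fun j hj => ?_⟩
      have := Finset.le_sup (f := fun j : ℤ => j.natAbs) hj
      omega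
    filter_upwards [eventually_ge_atTop M] with k hk
    have hdiff : S (k + 1) - w k ∈ U k := by
      rw [hS, hw, add_sub_cancel_left]
      refine Submodule.sum_mem _ fun j hj => Submodule.smul_mem _ _ ?_
      have h1 := hM j hj
      have h2 : j < 0 := hl hj
      have h3 : z ((k : ℤ) + 1 - -j) = w (k + j).toNat := by
        rw [hw]; congr 1; omega
      rw [h3]
      exact hwU (by omega)
    have hpyth : ‖g k‖ * ‖g k‖ ≤ ‖g k‖ * ‖S (k + 1)‖ := by
      have h1 : ⟪g k, S (k + 1)⟫_ℝ = ⟪g k, g k⟫_ℝ := by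
        have h2 : S (k + 1) = g k + ((S (k + 1) - w k) + (U k).starProjection (w k)) := by
          simp only [hg]; abel
        rw [h2, inner_add_right, horth k _ (add_mem hdiff (Submodule.starProjection_apply_mem _ _)),
          add_zero]
      rw [← real_inner_self_eq_norm_mul_norm, ← h1]
      exact real_inner_le_norm _ _
    have hpos : 0 < ‖g k‖ := (Real.sqrt_pos.2 hv).trans_le (hlower k)
    rw [← hSn (k + 1)] at hS0
    exact (le_of_mul_le_mul_left hpyth hpos).trans_lt hS0
  refine ⟨c, g, fun k => congrArg (w k - ·) (hc k).symm, fun i j hij => ?_, fun k => ?_, ?_⟩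
  · rcases hij.lt_or_gt with h | h
    · rw [real_inner_comm]; exact horth j _ (hgU h)
    · exact horth i _ (hgU h)
  · rw [← Real.sq_sqrt hv.le]
    exact pow_le_pow_left₀ (Real.sqrt_nonneg _) (hlower k) 2
  · simpa [Real.sq_sqrt hv.le] using hnorm.pow 2

end InnovationsHilbert

/-! ### Entropy of Gaussian vectors through a triangular change of variables. -/

section GaussianEntropy

lemma pi_gaussianReal_eq_withDensity {ι : Type*} [Fintype ι] (μ : ι → ℝ) (s : ι → ℝ≥0)
    (hs : ∀ i, s i ≠ 0) :
    Measure.pi (fun i => gaussianReal (μ i) (s i)) = (volume : Measure (ι → ℝ)).withDensity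
      (fun x => ENNReal.ofReal (∏ i, gaussianPDFReal (μ i) (s i) (x i))) := by
  refine Measure.pi_eq fun S hS => ?_
  have hint : Integrable (fun x : ι → ℝ => ∏ i, gaussianPDFReal (μ i) (s i) (x i))
      (Measure.pi fun i => (volume : Measure ℝ).restrict (S i)) :=
    Integrable.fintype_prod fun i => (integrable_gaussianPDFReal _ _).restrict
  rw [withDensity_apply _ (MeasurableSet.univ_pi hS), volume_pi, Measure.restrict_pi_pi,
    ← ofReal_integral_eq_lintegral_ofReal hint
      (ae_of_all _ fun x => Finset.prod_nonneg fun i _ => gaussianPDFReal_nonneg _ _ _),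
    integral_fintype_prod_eq_prod, ENNReal.ofReal_prod_of_nonneg]
  · exact Finset.prod_congr rfl fun i _ => (gaussianReal_apply_eq_integral _ (hs i) _).symm
  · exact fun i _ => integral_nonneg fun x => gaussianPDFReal_nonneg _ _ _

lemma log_gaussianPDFReal (μ : ℝ) {s : ℝ≥0} (hs : s ≠ 0) (x : ℝ) :
    Real.log (gaussianPDFReal μ s x) =
      -(1 / 2 * Real.log (2 * Real.pi * s)) - (x - μ) ^ 2 / (2 * s) := by
  have hs' : (0 : ℝ) < s := NNReal.coe_pos.2 (pos_iff_ne_zero.2 hs)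
  rw [gaussianPDFReal_def, Real.log_mul (by positivity) (by positivity), Real.log_exp,
    Real.log_inv, Real.log_sqrt (by positivity)]
  ring

lemma integrable_log_gaussianPDFReal (μ : ℝ) {s : ℝ≥0} (hs : s ≠ 0) :
    Integrable (fun x => Real.log (gaussianPDFReal μ s x)) (gaussianReal μ s) := by
  simp only [log_gaussianPDFReal μ hs]
  have h : MemLp (fun x : ℝ => x - μ) 2 (gaussianReal μ s) :=
    (memLp_id_gaussianReal' 2 (by simp)).sub (memLp_const μ)
  exact (integrable_const _).sub (h.integrable_sq.div_const _)

lemma integral_log_gaussianPDFReal (μ : ℝ) {s : ℝ≥0} (hs : s ≠ 0) :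
    ∫ x, Real.log (gaussianPDFReal μ s x) ∂(gaussianReal μ s) =
      -(1 / 2 * Real.log (2 * Real.pi * Real.exp 1 * s)) := by
  have hs' : (0 : ℝ) < s := NNReal.coe_pos.2 (pos_iff_ne_zero.2 hs)
  have h : MemLp (fun x : ℝ => x - μ) 2 (gaussianReal μ s) :=
    (memLp_id_gaussianReal' 2 (by simp)).sub (memLp_const μ)
  have hvar : ∫ x, (x - μ) ^ 2 ∂(gaussianReal μ s) = s := by
    have := variance_fun_id_gaussianReal (μ := μ) (v := s)
    rwa [variance_eq_integral (by fun_prop), integral_id_gaussianReal] at this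
  simp only [log_gaussianPDFReal μ hs]
  rw [integral_sub (integrable_const _) (h.integrable_sq.div_const _), integral_const,
    integral_div, hvar, probReal_univ, one_smul,
    show 2 * Real.pi * Real.exp 1 * (s : ℝ) = 2 * Real.pi * s * Real.exp 1 by ring,
    Real.log_mul (x := 2 * Real.pi * s) (by positivity) (by positivity), Real.log_exp]
  field_simp
  ring

variable {Ω : Type*} [MeasurableSpace Ω] {P : Measure Ω} [IsProbabilityMeasure P]

/-- Differential entropy of a random vector that a volume-preserving map turns into a vector of
independent Gaussian variables. -/
lemma differentialEntropy_of_volume_preserving {n : ℕ} {V : Ω → Fin n → ℝ}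
    (A : (Fin n → ℝ) ≃ᵐ (Fin n → ℝ)) (hA : MeasurePreserving A volume volume)
    (μ : Fin n → ℝ) (s : Fin n → ℝ≥0) (hs : ∀ i, s i ≠ 0)
    (hind : iIndepFun (fun i ω => A (V ω) i) P)
    (hlaw : ∀ i, HasLaw (fun ω => A (V ω) i) (gaussianReal (μ i) (s i)) P) :
    HasPDF V P volume ∧
    Integrable (fun x => (pdf V P volume x).toReal * Real.log (pdf V P volume x).toReal) ∧
    differentialEntropy V P = ∑ i, 1 / 2 * Real.log (2 * Real.pi * Real.exp 1 * s i) := by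
  set F : (Fin n → ℝ) → ℝ := fun x => ∏ i, gaussianPDFReal (μ i) (s i) (x i) with hF
  have hFm : Measurable F := Finset.measurable_prod _ fun i _ =>
    (measurable_gaussianPDFReal _ _).comp (measurable_pi_apply i)
  have hFpos : ∀ x, 0 < F x := fun x =>
    Finset.prod_pos fun i _ => gaussianPDFReal_pos _ _ _ (hs i)
  have hAV : AEMeasurable (fun ω => A (V ω)) P := aemeasurable_pi_iff.2 fun i => (hlaw i).aemeasurable
  have hV : AEMeasurable V P := by
    simpa [Function.comp_def] using A.symm.measurable.comp_aemeasurable hAV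
  have hmapAV : P.map (fun ω => A (V ω)) =
      (volume : Measure (Fin n → ℝ)).withDensity (fun x => ENNReal.ofReal (F x)) := by
    rw [(iIndepFun_iff_map_fun_eq_pi_map fun i => (hlaw i).aemeasurable).1 hind,
      ← pi_gaussianReal_eq_withDensity μ s hs]
    simp only [(hlaw _).map_eq]
  have hmapV : P.map V = (volume : Measure (Fin n → ℝ)).withDensity
      (fun x => ENNReal.ofReal (F (A x))) := by
    ext S hS
    have hS' : MeasurableSet (A.symm ⁻¹' S) := A.symm.measurable hS
    have h1 : P.map V S = P.map (fun ω => A (V ω)) (A.symm ⁻¹' S) := by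
      rw [Measure.map_apply_of_aemeasurable hV hS, Measure.map_apply_of_aemeasurable hAV hS']
      congr 1
      ext ω; simp
    rw [h1, hmapAV, withDensity_apply _ hS', withDensity_apply _ hS,
      ← hA.setLIntegral_comp_preimage hS' hFm.ennreal_ofReal]
    congr 2
    ext x; simp
  have hFA : Measurable fun x => F (A x) := hFm.comp A.measurable
  have hpdf : HasPDF V P volume :=
    hasPDF_of_map_eq_withDensity hV _ hFA.ennreal_ofReal.aemeasurable hmapV
  have hae : pdf V P volume =ᵐ[volume] fun x => ENNReal.ofReal (F (A x)) :=
    (pdf.eq_of_map_eq_withDensity' _ hFA.ennreal_ofReal.aemeasurable).1 hmapV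
  -- The entropy is `-E[log f(V)]`; along `V` the log-density splits into one-dimensional terms.
  have hlog : ∀ᵐ ω ∂P, Real.log (pdf V P volume (V ω)).toReal =
      ∑ i, Real.log (gaussianPDFReal (μ i) (s i) (A (V ω) i)) := by
    filter_upwards [ae_of_ae_map hV (HasPDF.absolutelyContinuous hae)] with ω hω
    rw [hω, ENNReal.toReal_ofReal (hFpos _).le, hF, Real.log_prod]
    exact fun i _ => (gaussianPDFReal_pos _ _ _ (hs i)).ne'
  have hmeas : AEStronglyMeasurable
      (fun x => Real.log (pdf V P volume x).toReal) (volume : Measure (Fin n → ℝ)) :=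
    (Real.measurable_log.comp (measurable_pdf V P volume).ennreal_toReal).aestronglyMeasurable
  have hterm : ∀ i, Integrable (fun ω => Real.log (gaussianPDFReal (μ i) (s i) (A (V ω) i))) P ∧
      ∫ ω, Real.log (gaussianPDFReal (μ i) (s i) (A (V ω) i)) ∂P =
        -(1 / 2 * Real.log (2 * Real.pi * Real.exp 1 * s i)) := by
    intro i
    have hm := (Real.measurable_log.comp
      (measurable_gaussianPDFReal (μ i) (s i))).aestronglyMeasurable
        (μ := P.map fun ω => A (V ω) i)
    have h1 := integrable_log_gaussianPDFReal (μ i) (hs i)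
    have h2 := integral_log_gaussianPDFReal (μ i) (hs i)
    rw [← (hlaw i).map_eq] at h1 h2
    exact ⟨h1.comp_aemeasurable (hlaw i).aemeasurable,
      (integral_map (hlaw i).aemeasurable hm).symm.trans h2⟩
  refine ⟨hpdf, ?_, ?_⟩
  · have h := (pdf.integrable_pdf_smul_iff (X := V) hmeas).2
      ((integrable_congr hlog).2 (integrable_finsetSum _ fun i _ => (hterm i).1))
    simpa only [smul_eq_mul] using h
  · have h : ∫ x, (pdf V P volume x).toReal • Real.log (pdf V P volume x).toReal =
        ∫ ω, Real.log (pdf V P volume (V ω)).toReal ∂P := pdf.integral_pdf_smul hmeas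
    simp only [smul_eq_mul] at h
    rw [differentialEntropy, h, integral_congr_ae hlog,
      integral_finsetSum _ fun i _ => (hterm i).1, Finset.sum_congr rfl fun i _ => (hterm i).2,
      Finset.sum_neg_distrib, neg_neg]

lemma exists_measurableEquiv_of_det_eq_one {n : ℕ} {M : Matrix (Fin n) (Fin n) ℝ}
    (hM : M.det = 1) : ∃ A : (Fin n → ℝ) ≃ᵐ (Fin n → ℝ),
      MeasurePreserving A volume volume ∧ ∀ x, A x = M.mulVec x := by
  have hdet : LinearMap.det (Matrix.toLin' M) = 1 := by rw [LinearMap.det_toLin', hM]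
  set L := LinearEquiv.ofIsUnitDet (f := Matrix.toLin' M) (v := Pi.basisFun ℝ (Fin n))
    (v' := Pi.basisFun ℝ (Fin n)) (by
      rw [← Matrix.toLin_eq_toLin', LinearMap.toMatrix_toLin, hM]; exact isUnit_one)
  refine ⟨L.toContinuousLinearEquiv.toHomeomorph.toMeasurableEquiv,
    ⟨MeasurableEquiv.measurable _, ?_⟩, fun x => rfl⟩
  have h := Real.map_linearMap_volume_pi_eq_smul_volume_pi (f := Matrix.toLin' M)
    (by rw [hdet]; exact one_ne_zero)
  rw [hdet] at h
  change Measure.map (Matrix.toLin' M) volume = volume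
  simpa using h

/-- The entropy of the blocks of a Gaussian process with given one-step prediction residuals. -/
lemma differentialEntropy_block {Z : ℤ → Ω → ℝ} (hZ : IsGaussianProcess Z P) (c : ℕ → ℕ → ℝ)
    (hcov : ∀ i j : ℕ, i ≠ j →
      cov[fun ω => Z (i + 1) ω - ∑ l ∈ Finset.range i, c i l * Z (l + 1) ω,
        fun ω => Z (j + 1) ω - ∑ l ∈ Finset.range j, c j l * Z (l + 1) ω; P] = 0)
    (hvar : ∀ k : ℕ,
      0 < Var[fun ω => Z (k + 1) ω - ∑ l ∈ Finset.range k, c k l * Z (l + 1) ω; P]) (n : ℕ) :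
    HasPDF (block Z n) P volume ∧
    Integrable (fun x : Fin n → ℝ =>
      (pdf (block Z n) P volume x).toReal * Real.log (pdf (block Z n) P volume x).toReal) ∧
    differentialEntropy (block Z n) P = ∑ k ∈ Finset.range n, 1 / 2 *
      Real.log (2 * Real.pi * Real.exp 1 *
        Var[fun ω => Z (k + 1) ω - ∑ l ∈ Finset.range k, c k l * Z (l + 1) ω; P]) := by
  -- `M` sends the block to its residuals. It is unit lower triangular, so it preserves volume.
  set M : Matrix (Fin n) (Fin n) ℝ := Matrix.of fun i j =>
    (if i = j then 1 else 0) - (if j < i then c i j else 0) with hMdef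
  have hM : M.det = 1 := by
    rw [Matrix.det_of_isLowerTriangular]
    · simp [hMdef]
    · intro i j hij
      have hij' : i < j := hij
      simp [hMdef, hij'.ne, hij'.not_gt]
  obtain ⟨A, hA, hAM⟩ := exists_measurableEquiv_of_det_eq_one hM
  have hAV : ∀ (i : Fin n) ω, A (block Z n ω) i =
      Z (i + 1) ω - ∑ l ∈ Finset.range i, c i l * Z (l + 1) ω := by
    intro i ω
    rw [hAM]
    simp only [Matrix.mulVec, dotProduct, hMdef, Matrix.of_apply, sub_mul, ite_mul, one_mul,
      zero_mul, Finset.sum_sub_distrib, Finset.sum_ite_eq, Finset.mem_univ, if_true, block]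
    congr 1
    have h := Fin.sum_univ_eq_sum_range
      (fun l : ℕ => if l < i then c i l * Z (l + 1) ω else 0) n
    simp only [Fin.lt_def]
    rw [h, ← Finset.sum_filter]
    refine Finset.sum_congr ?_ fun _ _ => rfl
    ext l
    simp only [Finset.mem_filter, Finset.mem_range]
    omega
  have hblock : HasGaussianLaw (block Z n) P := by
    let T : (((Finset.univ : Finset (Fin n)).image fun i : Fin n => (i : ℤ) + 1) → ℝ) →L[ℝ]
        (Fin n → ℝ) := ContinuousLinearMap.pi fun i => ContinuousLinearMap.proj
          ⟨(i : ℤ) + 1, Finset.mem_image_of_mem _ (Finset.mem_univ i)⟩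
    exact (hZ.hasGaussianLaw _).map T
  have hG : HasGaussianLaw (fun ω i => A (block Z n ω) i) P := by
    have h := hblock.map (LinearMap.toContinuousLinearMap (Matrix.toLin' M))
    have heq : (fun ω i => A (block Z n ω) i) =
        LinearMap.toContinuousLinearMap (Matrix.toLin' M) ∘ block Z n := by
      funext ω
      simp [hAM]
    rw [heq]
    exact h
  have hGi : ∀ i, HasGaussianLaw (fun ω => A (block Z n ω) i) P := fun i => hG.eval i
  have hind : iIndepFun (fun i ω => A (block Z n ω) i) P := by
    -- The residuals are jointly Gaussian, so being uncorrelated makes them independent.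
    refine hG.iIndepFun_of_covariance_eq_zero fun i j hij => ?_
    simp only [hAV]
    exact hcov i j (fun h => hij (Fin.ext h))
  have hV : ∀ i : Fin n, Var[fun ω => A (block Z n ω) i; P] =
      Var[fun ω => Z ((i : ℕ) + 1) ω - ∑ l ∈ Finset.range i, c i l * Z (l + 1) ω; P] := by
    intro i; simp only [hAV]
  have h := differentialEntropy_of_volume_preserving (P := P) (V := block Z n) A hA
    (fun i => P[fun ω => A (block Z n ω) i]) (fun i => Var[fun ω => A (block Z n ω) i; P].toNNReal)
    (fun i => by rw [hV]; exact (Real.toNNReal_pos.2 (hvar i)).ne') hind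
    (fun i => ⟨(hGi i).aemeasurable, (hGi i).map_eq_gaussianReal⟩)
  refine ⟨h.1, h.2.1, h.2.2.trans ?_⟩
  rw [← Fin.sum_univ_eq_sum_range (fun k : ℕ => 1 / 2 * Real.log (2 * Real.pi * Real.exp 1 *
        Var[fun ω => Z (k + 1) ω - ∑ l ∈ Finset.range k, c k l * Z (l + 1) ω; P]))]
  refine Finset.sum_congr rfl fun i _ => ?_
  rw [Real.coe_toNNReal _ (variance_nonneg _ _), hV]

end GaussianEntropy

/-! ### Transfer to `L²` and the entropy rate. -/

section EntropyRate

open scoped InnerProductSpace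

variable {Ω : Type*} [MeasurableSpace Ω] {P : Measure Ω}

/-- Centering `f ↦ f - E f`, as an operator on `L²`. -/
noncomputable def centerL2 (P : Measure Ω) [IsProbabilityMeasure P] :
    Lp ℝ 2 P →L[ℝ] Lp ℝ 2 P :=
  ContinuousLinearMap.id ℝ _ -
    (innerSL ℝ (memLp_const (μ := P) (p := 2) (1 : ℝ)).toLp).smulRight
      (memLp_const (μ := P) (p := 2) (1 : ℝ)).toLp

lemma inner_toLp {f g : Ω → ℝ} (hf : MemLp f 2 P) (hg : MemLp g 2 P) :
    ⟪hf.toLp, hg.toLp⟫_ℝ = ∫ ω, f ω * g ω ∂P := by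
  rw [L2.inner_def]
  refine integral_congr_ae ?_
  filter_upwards [hf.coeFn_toLp, hg.coeFn_toLp] with ω h1 h2
  rw [h1, h2]
  exact mul_comm _ _

/-- The mean of `Z` is not assumed to vanish; centering makes the Hilbert-space argument speak of
covariances. -/
lemma inner_centerL2 [IsProbabilityMeasure P] {f g : Ω → ℝ} (hf : MemLp f 2 P) (hg : MemLp g 2 P) :
    ⟪centerL2 P hf.toLp, centerL2 P hg.toLp⟫_ℝ = cov[f, g; P] := by
  rw [covariance_eq_sub hf hg]
  simp only [centerL2, _root_.sub_apply, ContinuousLinearMap.id_apply,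
    ContinuousLinearMap.smulRight_apply, innerSL_apply_apply, inner_sub_left, inner_sub_right,
    real_inner_smul_left, real_inner_smul_right, inner_toLp, one_mul, mul_one, integral_const,
    probReal_univ, smul_eq_mul, Pi.mul_apply]
  ring

lemma toLp_sum_mul {ι : Type*} (s : Finset ι) (c : ι → ℝ) {f : ι → Ω → ℝ}
    (hf : ∀ i, MemLp (f i) 2 P) (h : MemLp (fun ω => ∑ i ∈ s, c i * f i ω) 2 P) :
    h.toLp = ∑ i ∈ s, c i • (hf i).toLp := by
  classical
  induction s using Finset.induction_on with
  | empty => simp only [Finset.sum_empty]; exact MemLp.toLp_zero _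
  | insert i s hi ih =>
    have hs : MemLp (fun ω => ∑ i ∈ s, c i * f i ω) 2 P :=
      memLp_finsetSum _ fun i _ => (hf i).const_mul (c i)
    rw [Finset.sum_insert hi, ← ih hs, ← MemLp.toLp_const_smul, ← MemLp.toLp_add]
    refine MemLp.toLp_congr _ _ (ae_of_all _ fun ω => ?_)
    simp [Finset.sum_insert hi]

lemma covariance_shift [IsProbabilityMeasure P] {Z : ℤ → Ω → ℝ} (hZ : ∀ n, MemLp (Z n) 2 P)
    (hs : IsStationaryProcess Z P) (m i j : ℤ) :
    cov[Z (i + m), Z (j + m); P] = cov[Z i, Z j; P] := by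
  rw [covariance_eq_sub (hZ _) (hZ _), covariance_eq_sub (hZ _) (hZ _)]
  have h1 := ((hs m).comp ((measurable_pi_apply i).mul (measurable_pi_apply j))).integral_eq
  have h2 := ((hs m).comp (measurable_pi_apply i)).integral_eq
  have h3 := ((hs m).comp (measurable_pi_apply j)).integral_eq
  simp only [Function.comp_def, Pi.mul_apply] at h1 h2 h3 ⊢
  rw [h1, h2, h3]

lemma covariance_noise {ε : ℤ → Ω → ℝ} {v : ℝ≥0} (hε : IsGaussianNoise ε v P) (i j : ℤ) :
    cov[ε i, ε j; P] = if i = j then (v : ℝ) else 0 := by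
  have hL : ∀ n, MemLp (ε n) 2 P := fun n => (hε.2 n).hasGaussianLaw.memLp_two
  split_ifs with h
  · rw [h, covariance_self (hL j).aemeasurable, (hε.2 j).variance_eq, variance_id_gaussianReal]
  · exact (hε.1.indepFun h).covariance_eq_zero (hL i) (hL j)

theorem hasEntropyRate_of_isARFIMA [IsProbabilityMeasure P] {a b : ℝ[X]} {d : ℝ} {Z ε : ℤ → Ω → ℝ} {v : ℝ≥0} (hv : 0 < v)
    (hd : -(1 / 2) < d) (hd' : d < 1 / 2) (h : IsARFIMA a b d Z ε v P)
    (ha0 : a.coeff 0 = 1) (ha : RootsOutsideUnitDisc a)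
    (hb0 : b.coeff 0 = 1) (hb : RootsOutsideUnitDisc b) :
    HasEntropyRate Z P (1 / 2 * Real.log (2 * Real.pi * Real.exp 1 * (v : ℝ))) := by
  obtain ⟨hG, hs, hε, Y, hY, hab⟩ := h
  have hZL : ∀ n, MemLp (Z n) 2 P := fun n => (hG.hasGaussianLaw_eval n).memLp_two
  have hεL : ∀ n, MemLp (ε n) 2 P := fun n => (hε.2 n).hasGaussianLaw.memLp_two
  have hYL : ∀ n, MemLp (Y n) 2 P := fun n => (hY n).1
  have hlag : ∀ (p : ℝ[X]) (X : ℤ → Ω → ℝ) (hX : ∀ n, MemLp (X n) 2 P) (n : ℤ),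
      ∃ hp : MemLp (lagApply p X n) 2 P, centerL2 P hp.toLp =
        p.sum fun i c => c • centerL2 P (hX (n - i)).toLp := by
    intro p X hX n
    have hp : MemLp (lagApply p X n) 2 P :=
      memLp_finsetSum _ fun i _ => (hX (n - i)).const_mul (p.coeff i)
    refine ⟨hp, ?_⟩
    rw [Polynomial.sum_def]
    simp only [← map_smul, ← map_sum]
    exact congrArg _ (toLp_sum_mul p.support p.coeff (fun i : ℕ => hX (n - i)) hp)
  obtain ⟨c, g, hgz, hg, hgv, hglim⟩ := exists_innovations
    (z := fun n => centerL2 P (hZL n).toLp) (y := fun n => centerL2 P (hYL n).toLp)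
    (e := fun n => centerL2 P (hεL n).toLp) (v := v) (a := a) (b := b) hd hd' (by exact_mod_cast hv)
    (fun m i j => by
      simp only [inner_centerL2]
      exact covariance_shift hZL hs m i j)
    (fun n => by
      have hS : ∀ N, MemLp (fun ω => ∑ k ∈ Finset.range N,
          fracDiffCoeff d k * Z (n - (k : ℤ)) ω) 2 P := fun N =>
        memLp_finsetSum _ fun k _ => (hZL _).const_mul _
      have h := ((centerL2 P).continuous.tendsto _).comp
        ((Lp.tendsto_Lp_iff_tendsto_eLpNorm'' _ hS _ (hYL n)).2 (hY n).2)
      refine h.congr fun N => ?_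
      rw [Function.comp_apply, toLp_sum_mul _ _ (fun k : ℕ => hZL (n - k)) (hS N)]
      simp only [map_sum, map_smul])
    ha0 ha hb0 hb
    (fun i j => by rw [inner_centerL2]; exact covariance_noise hε i j)
    (fun n => by
      obtain ⟨h1, h1'⟩ := hlag a Y hYL n
      obtain ⟨h2, h2'⟩ := hlag b ε hεL n
      rw [← h1', ← h2', MemLp.toLp_congr h1 h2 (hab n)])
  have hGL : ∀ k : ℕ, MemLp (fun ω => Z (k + 1) ω - ∑ l ∈ Finset.range k, c k l * Z (l + 1) ω) 2 P :=
    fun k => (hZL _).sub (memLp_finsetSum _ fun l _ => (hZL _).const_mul _)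
  have hgG : ∀ k, g k = centerL2 P (hGL k).toLp := by
    intro k
    rw [hgz]
    simp only [← map_smul, ← map_sum, ← map_sub]
    congr 1
    rw [← toLp_sum_mul _ (c k) (fun l : ℕ => hZL (l + 1))
      (memLp_finsetSum _ fun l _ => (hZL _).const_mul _), ← MemLp.toLp_sub]
    rfl
  have hvar : ∀ k : ℕ, Var[fun ω => Z (k + 1) ω - ∑ l ∈ Finset.range k, c k l * Z (l + 1) ω; P] =
      ‖g k‖ ^ 2 := by
    intro k
    rw [← covariance_self (hGL k).aemeasurable, ← inner_centerL2 (hGL k) (hGL k), ← hgG,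
      real_inner_self_eq_norm_sq]
  have hent := differentialEntropy_block hG c
    (fun i j hij => by rw [← inner_centerL2 (hGL i) (hGL j), ← hgG, ← hgG, hg i j hij])
    (fun k => by
      rw [hvar]
      exact lt_of_lt_of_le (by exact_mod_cast hv) (hgv k))
  refine ⟨fun n => ⟨(hent n).1, (hent n).2.1⟩, ?_⟩
  have hpos : 2 * Real.pi * Real.exp 1 * (v : ℝ) ≠ 0 := by
    have : (0 : ℝ) < v := by exact_mod_cast hv
    positivity
  -- The entropy increments converge, and `h(Z_1, …, Z_n) / n` is their Cesàro mean.
  have hces := (((hglim.const_mul (2 * Real.pi * Real.exp 1)).log hpos).const_mul (1 / 2)).cesaro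
  refine hces.congr fun n => ?_
  simp only [(hent n).2.2, hvar]
  exact (div_eq_inv_mul _ _).symm

lemma IsARMA.isARFIMA {a b : ℝ[X]} {Z ε : ℤ → Ω → ℝ} {v : ℝ≥0} (h : IsARMA a b Z ε v P) :
    IsARFIMA a b 0 Z ε v P := by
  refine ⟨h.1, h.2.1, h.2.2.1, Z, fun n => ⟨(h.1.hasGaussianLaw_eval n).memLp_two, ?_⟩, h.2.2.2⟩
  refine tendsto_const_nhds.congr' ?_
  -- For `d = 0` every nonempty partial sum is exactly `Z n`.
  filter_upwards [eventually_gt_atTop 0] with N hN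
  simp [fracDiffCoeff_zero_left, hN]

lemma coeff_zero_arPoly {p : ℕ} (φ : Fin p → ℝ) : (arPoly φ).coeff 0 = 1 := by
  simp [arPoly]

lemma coeff_zero_maPoly {q : ℕ} (ψ : Fin q → ℝ) : (maPoly ψ).coeff 0 = 1 := by
  simp [maPoly]

lemma rootsOutsideUnitDisc_one : RootsOutsideUnitDisc 1 := fun z hz => by simp at hz

end EntropyRate

theorem mainTheorem6 {Ω : Type*} [MeasurableSpace Ω] (P : Measure Ω) [IsProbabilityMeasure P]
    {p q : ℕ} (φ : Fin p → ℝ) (ψ : Fin q → ℝ) (v : ℝ≥0) (hv : 0 < v)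
    (Z ε : ℤ → Ω → ℝ) :
    -- stationary ARFIMA(p,d,q) with invertible moving-average polynomial
    (∀ d : ℝ, -(1 / 2) < d → d < 1 / 2 → IsARFIMA (arPoly φ) (maPoly ψ) d Z ε v P →
      RootsOutsideUnitDisc (arPoly φ) → RootsOutsideUnitDisc (maPoly ψ) →
      HasEntropyRate Z P (1 / 2 * Real.log (2 * Real.pi * Real.exp 1 * (v : ℝ)))) ∧
    -- stationary AR(p)
    (IsARMA (arPoly φ) 1 Z ε v P → RootsOutsideUnitDisc (arPoly φ) →
      HasEntropyRate Z P (1 / 2 * Real.log (2 * Real.pi * Real.exp 1 * (v : ℝ)))) ∧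
    -- invertible MA(q)
    (IsARMA 1 (maPoly ψ) Z ε v P → RootsOutsideUnitDisc (maPoly ψ) →
      HasEntropyRate Z P (1 / 2 * Real.log (2 * Real.pi * Real.exp 1 * (v : ℝ)))) ∧
    -- stationary and invertible ARMA(p,q)
    (IsARMA (arPoly φ) (maPoly ψ) Z ε v P →
      RootsOutsideUnitDisc (arPoly φ) → RootsOutsideUnitDisc (maPoly ψ) →
      HasEntropyRate Z P (1 / 2 * Real.log (2 * Real.pi * Real.exp 1 * (v : ℝ)))) := by
  have h0 : -(1 / 2 : ℝ) < 0 := by norm_num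
  have h0' : (0 : ℝ) < 1 / 2 := by norm_num
  have ha0 := coeff_zero_arPoly φ
  have hb0 := coeff_zero_maPoly ψ
  refine ⟨fun d hd hd' h ha hb => hasEntropyRate_of_isARFIMA hv hd hd' h ha0 ha hb0 hb,
    fun h ha => ?_, fun h hb => ?_, fun h ha hb => ?_⟩
  · exact hasEntropyRate_of_isARFIMA hv h0 h0' h.isARFIMA ha0 ha Polynomial.coeff_one_zero
      rootsOutsideUnitDisc_one
  · exact hasEntropyRate_of_isARFIMA hv h0 h0' h.isARFIMA Polynomial.coeff_one_zero
      rootsOutsideUnitDisc_one hb0 hb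
  · exact hasEntropyRate_of_isARFIMA hv h0 h0' h.isARFIMA ha0 ha hb0 hb
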